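/- Let $\mathbb{F}_q$ be a finite field with $q$ elements, $F$ a finite separable extension of the rational function field $\mathbb{F}_q(t)$, and $K/F$ a finite abelian extension with Galois group $G$, such that $\mathbb{F}_q$ is algebraically closed in $K$. Let $\mathcal{R}$ be a Dedekind domain with field of fractions $F$ (it automatically contains $\mathbb{F}_q$), and let $\mathcal{S}$ be its integral closure in $K$. Write $\mathrm{MSpec}(\mathcal{R})$ for the set of non-zero prime ideals of $\mathcal{R}$ and $\mathcal{O}_v$ for the $v$-adic completion of $\mathcal{R}$ at $v\in\mathrm{MSpec}(\mathcal{R})$. We say that $v$ is tame in $K/F$ if, for every prime $w$ of $\mathcal{S}$ above $v$, the ramification index $e(w/v)$ is prime to the characteristic of $\mathcal{R}/v$ and the extension of residue fields is separable, and that $\mathcal{S}/\mathcal{R}$ is tame if all $v\in\mathrm{MSpec}(\mathcal{R})$ are tame. For an $\mathcal{R}$-module $N$, write $N/v:=N/vN$. An $\mathcal{R}\{\tau\}[G]$-submodule of $\mathcal{S}$ is an $\mathcal{R}$-submodule of $\mathcal{S}$ that is stable under $G$ and under the Frobenius $\tau\colon x\mapsto x^q$. Such a submodule $\mathcal{M}$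 is called a taming module for $\mathcal{S}/\mathcal{R}$ if (a) $\mathcal{M}$ is a projective $\mathcal{R}[G]$-module of constant local rank $1$, and (b) $\mathcal{S}/\mathcal{M}$ is finite and $(\mathcal{S}/\mathcal{M})\otimes_{\mathcal{R}}\mathcal{O}_v=0$ for every $v\in\mathrm{MSpec}(\mathcal{R})$ that is tame in $K/F$. Then: 1. Taming modules for $\mathcal{S}/\mathcal{R}$ exist. 2. If $\mathcal{S}/\mathcal{R}$ is tame, then every taming module $\mathcal{M}$ for $\mathcal{S}/\mathcal{R}$ equals $\mathcal{S}$. 3. For every taming module $\mathcal{M}$ and every $v\in\mathrm{MSpec}(\mathcal{R})$, the degree $n_v:=[\mathcal{R}/v:\mathbb{F}_q]$ is finite and there is an isomorphism of $\mathbb{F}_q[G]$-modules $\mathcal{M}/v\simeq\mathbb{F}_q[G]^{n_v}$. 4. For every taming module $\mathcal{M}$ and every $v\in\mathrm{MSpec}(\mathcal{R})$ that is tame in $K/F$, we have $\mathcal{M}/v=\mathcal{S}/v$, i.e. the inclusion $\mathcal{M}\subseteq\mathcal{S}$ induces a bijection $\mathcal{M}/v\to\mathcal{S}/v$. -/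

import Mathlib

open IsDedekindDomain
open scoped MonoidAlgebra TensorProduct IsMulCommutative

noncomputable section

section Fiber

variable {R N : Type*} [CommRing R] [AddCommGroup N] [Module R N]

/-- The fibre `N/v := N/vN` of an `R`-module `N` at an ideal `v` of `R`. -/
abbrev ModFiber (v : Ideal R) (N : Type*) [AddCommGroup N] [Module R N] : Type _ :=
  N ⧸ (v • (⊤ : Submodule R N))

/-- A linear map carries `vN` into `vN'`. -/
theorem smul_top_le_comap_smul_top {N' : Type*} [AddCommGroup N'] [Module R N'] (v : Ideal R)
    (f : N →ₗ[R] N') :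
    v • (⊤ : Submodule R N) ≤ (v • (⊤ : Submodule R N')).comap f := by
  rw [← Submodule.map_le_iff_le_comap, Submodule.map_smul'']
  exact Submodule.smul_mono le_rfl le_top

/-- The map `N/v → N'/v` induced by an `R`-linear map `N → N'`. -/
def ModFiber.map {N' : Type*} [AddCommGroup N'] [Module R N'] (v : Ideal R) (f : N →ₗ[R] N') :
    ModFiber v N →ₗ[R] ModFiber v N' :=
  Submodule.mapQ _ _ f (smul_top_le_comap_smul_top v f)

theorem ModFiber.map_mk {N' : Type*} [AddCommGroup N'] [Module R N'] (v : Ideal R)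
    (f : N →ₗ[R] N') (x : N) :
    ModFiber.map v f (Submodule.Quotient.mk x) = Submodule.Quotient.mk (f x) :=
  rfl

/-- If `G` acts `R`-linearly on `N` and `R` is an algebra over `k`, then `G` acts `k`-linearly on
the fibre `N/v`. -/
def ModFiber.rep (k : Type*) [Field k] [Algebra k R] [Module k N] [IsScalarTower k R N]
    {G : Type*} [Group G] (ρ : Representation R G N) (v : Ideal R) :
    Representation k G (ModFiber v N) where
  toFun g := (ModFiber.map v (ρ g)).restrictScalars k
  map_one' := by
    refine LinearMap.ext fun x => ?_
    obtain ⟨x, rfl⟩ := Submodule.Quotient.mk_surjective _ x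
    rw [LinearMap.restrictScalars_apply, ModFiber.map_mk, map_one]
    rfl
  map_mul' g h := by
    refine LinearMap.ext fun x => ?_
    obtain ⟨x, rfl⟩ := Submodule.Quotient.mk_surjective _ x
    rw [LinearMap.restrictScalars_apply, ModFiber.map_mk, map_mul]
    rfl

end Fiber

section Taming

variable (k R F K : Type*) [Field k] [CommRing R] [IsDedekindDomain R] [Field F] [Field K]
  [Algebra R F] [IsFractionRing R F] [Algebra F K] [Algebra R K] [IsScalarTower R F K]

/-- The `R`-linear action of `G = Gal(K/F)` on the integral closure `S` of `R` in `K`. -/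
def galRep : Representation R Gal(K/F) (integralClosure R K) :=
  Representation.ofDistribMulAction R Gal(K/F) (integralClosure R K)

/-- The maximal ideal `v` of `R` is tame in `K/F`: for every prime `w` of the integral closure `S`
of `R` in `K` lying over `v`, the ramification index `e(w/v)` is not divisible by the
characteristic of `R/v` and the residue field extension is separable. In particular unramified
primes are tame. -/
def IsTameAt (v : HeightOneSpectrum R) : Prop :=
  ∀ (w : Ideal (integralClosure R K)) [w.IsPrime] [w.LiesOver v.asIdeal],
    ¬ ringChar (R ⧸ v.asIdeal) ∣ w.ramificationIdx R ∧
      Algebra.IsSeparable (R ⧸ v.asIdeal) (integralClosure R K ⧸ w)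

/-- The `R{τ}[G]`-submodules of the integral closure `S` of `R` in `K`, where `τ` acts as the
`q`-power Frobenius with `q` the number of elements of `k`: these are the additive subgroups stable
under `R`, under `G` and under `τ`. -/
structure TauGSubmodule extends Subrepresentation (galRep R F K) where
  pow_mem_toSubmodule ⦃x : integralClosure R K⦄ :
    x ∈ toSubmodule → x ^ Nat.card k ∈ toSubmodule

variable {k R F K}

/-- The underlying `R[G]`-module of an `R{τ}[G]`-submodule of `S`. -/
abbrev TauGSubmodule.AsModule (M : TauGSubmodule k R F K) : Type _ :=
  M.toSubrepresentation.toRepresentation.asModule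

/-- Taming modules for `S/R`. -/
structure IsTamingModule [IsAbelianGalois F K] (M : TauGSubmodule k R F K) : Prop where
  projective : Module.Projective R[Gal(K/F)] M.AsModule
  rank_eq_one : ∀ P : PrimeSpectrum R[Gal(K/F)], Module.rankAtStalk M.AsModule P = 1
  finite_quotient : Finite (integralClosure R K ⧸ M.toSubmodule)
  quotient_tensor_eq_zero : ∀ v : HeightOneSpectrum R, IsTameAt R K v →
    Subsingleton ((integralClosure R K ⧸ M.toSubmodule) ⊗[R] v.adicCompletionIntegers F)

/-- `M/v` as an `𝔽_q[G]`-module. -/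
abbrev TauGSubmodule.FiberAsModule [Algebra k R] [Algebra k K] [IsScalarTower k R K]
    (M : TauGSubmodule k R F K) (v : Ideal R) : Type _ :=
  (ModFiber.rep k M.toSubrepresentation.toRepresentation v).asModule

end Taming

end

/-!
Write `S` for the integral closure of `R` in `K`, `G` for the Galois group and `q` for the order of
`k`.

*Existence.* Let `θ` generate a normal basis of `K/F`. After scaling by an element of `R`, the
lattice `N = R[G]θ` lies in `S` and is stable under `x ↦ x ^ q`
(`exists_basis_pow_mem_span`, `pow_card_mem_span_range`). Let `I` be the ideal of traces of elements
of `S`; it is contained in no tame prime (`IsTameAt.exists_trace_notMem`). The taming module is the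
set `M` of those `x ∈ S` that an element of `1 + I` carries into `N` (`latticeSaturation`): at the
primes containing `I` it agrees with the free module `N`, and at all other primes, in particular at
the tame ones, it agrees with `S`. It is projective by Higman's criterion
(`Representation.projective_asModule_of_sum_eq`): the identity of `N` is a sum of conjugates because
`N` is free, the elements of `I` are sums of conjugates on `S` by definition, and
`projective_latticeSaturation` combines the two without localizing. Its rank is one since `rM ⊆ N`
for some `r ≠ 0`, and every prime of `R[G]` contains one that lies over `0`
(`rankAtStalk_eq_one_of_smul_mem_range`).

*Tame primes.* If `v` is tame, then `(S/M) ⊗ O_v = 0` gives `S = M + vS`, so that by Nakayama's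
lemma an element of `1 + v` carries `S` into `M` (`IsTamingModule.exists_smul_mem`). Hence `M/v` and
`S/v` agree, and if all `v` are tame, the annihilator of `S/M` is the unit ideal.

*Fibres.* All proper quotients of `R` are finite (`hasFiniteQuotients_of_ratFunc`), hence
`R[G]/vR[G]` is semilocal and a projective module of rank one becomes free over it. So `M/v` is
cyclic over `R[G]` with as many elements as `(R/v)[G]`, which makes it free over `k[G]`
(`nonempty_fiber_linearEquiv`).
-/

/-! ### Orders of function fields have finite quotients -/

section FunctionField

open Polynomial Cardinal Algebra

variable (k F : Type*) [Field k] [Field F] [Algebra k F] [Algebra (RatFunc k) F]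
  [IsScalarTower k (RatFunc k) F]

theorem trdeg_eq_one_of_isAlgebraic_ratFunc [Algebra.IsAlgebraic (RatFunc k) F] :
    Algebra.trdeg k F = 1 := by
  have h₁ : Algebra.trdeg k (RatFunc k) = 1 := by
    have : Algebra.IsAlgebraic k[X] (RatFunc k) := IsLocalization.isAlgebraic _ (nonZeroDivisors _)
    have h := trdeg_add_eq k k[X] (A := RatFunc k)
    rw [Polynomial.trdeg_of_isDomain, trdeg_eq_zero, add_zero] at h
    exact h.symm
  have h := lift_trdeg_add_eq k (RatFunc k) F
  rw [h₁, trdeg_eq_zero] at h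
  simpa using h.symm

theorem essFiniteType_of_finite_ratFunc [FiniteDimensional (RatFunc k) F] :
    Algebra.EssFiniteType k F := by
  have : Algebra.EssFiniteType k[X] (RatFunc k) := .of_isLocalization _ (nonZeroDivisors _)
  have := Algebra.EssFiniteType.comp k k[X] (RatFunc k)
  exact Algebra.EssFiniteType.comp k (RatFunc k) F

variable {k F}

/-- A family of polynomials satisfying a linear relation with coefficients whose reductions modulo
`x` are linearly independent is divisible by every power of `X`. -/
theorem X_pow_dvd_of_sum_aeval_mul_eq_zero {R ι : Type*} [Fintype ι] [CommRing R] [IsDomain R]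
    [Algebra k R] {x : R} (hx : x ≠ 0) {y : ι → R}
    (hy : LinearIndependent k fun i => Ideal.Quotient.mk (Ideal.span {x}) (y i))
    (n : ℕ) (f : ι → k[X]) (hf : ∑ i, aeval x (f i) * y i = 0) (i : ι) : X ^ n ∣ f i := by
  induction n generalizing f i with
  | zero => simp
  | succ n ih =>
    have key : ∀ i, (f i).coeff 0 = 0 := by
      refine Fintype.linearIndependent_iff.1 hy (fun i => (f i).coeff 0) ?_
      have h := congrArg (Ideal.Quotient.mk (Ideal.span {x})) hf
      rw [map_sum, map_zero] at h
      rw [← h]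
      refine Finset.sum_congr rfl fun i _ => ?_
      have h0 : Ideal.Quotient.mk (Ideal.span {x}) (aeval x (f i))
          = algebraMap k _ ((f i).coeff 0) := by
        conv_lhs => rw [← divX_mul_X_add (f i)]
        have : Ideal.Quotient.mk (Ideal.span {x}) x = 0 :=
          Ideal.Quotient.eq_zero_iff_mem.2 (Ideal.mem_span_singleton_self x)
        simp only [map_add, map_mul, aeval_X, this, mul_zero, zero_add, aeval_C]
        rfl
      rw [map_mul, h0, Algebra.smul_def]
    have hX : ∀ i, f i = divX (f i) * X := fun i => by
      conv_lhs => rw [← divX_mul_X_add (f i), key i, map_zero, add_zero]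
    have hg : ∑ i, aeval x (divX (f i)) * y i = 0 := by
      refine (mul_eq_zero.1 (?_ : x * _ = 0)).resolve_left hx
      rw [← hf, Finset.mul_sum]
      refine Finset.sum_congr rfl fun i _ => ?_
      conv_rhs => rw [hX i]
      simp only [map_mul, aeval_X]
      ring
    rw [hX i, pow_succ]
    exact mul_dvd_mul_right (ih _ hg i) X

/-- If `x` is transcendental over `k`, the `k`-dimension of `R/xR` is at most `[F : k(x)]`, because
elements of `R` that are independent modulo `x` are independent over `k[x]`. If `x` is algebraic,
it is a unit of `R`. -/
theorem finite_quotient_span_singleton [FiniteDimensional (RatFunc k) F] {R : Type*} [CommRing R]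
    [IsDomain R] [Algebra R F] [FaithfulSMul R F] [Algebra k R] [IsScalarTower k R F]
    {x : R} (hx : x ≠ 0) : Module.Finite k (R ⧸ Ideal.span {x}) := by
  by_cases hxa : IsAlgebraic k x
  · have hu : IsUnit x := hxa.isIntegral.isUnit hx
    have : Subsingleton (R ⧸ Ideal.span {x}) :=
      Ideal.Quotient.subsingleton_iff.2 (Ideal.span_singleton_eq_top.2 hu)
    infer_instance
  · have hinj : Function.Injective (algebraMap R F) := FaithfulSMul.algebraMap_injective R F
    have hxF : Transcendental k (algebraMap R F x) := fun h =>
      hxa ((isAlgebraic_algebraMap_iff hinj).1 h)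
    have htr := trdeg_eq_one_of_isAlgebraic_ratFunc k F
    have hess := essFiniteType_of_finite_ratFunc k F
    let : Algebra k[X] F := (aeval (algebraMap R F x)).toAlgebra
    have hmap : ∀ p : k[X], algebraMap k[X] F p = algebraMap R F (aeval x p) := fun p =>
      aeval_algebraMap_apply F x p
    have : IsScalarTower k k[X] F := .of_algebraMap_eq fun c => by
      rw [hmap, ← C_eq_algebraMap, aeval_C, ← IsScalarTower.algebraMap_apply]
    have : FaithfulSMul k[X] F := (faithfulSMul_iff_algebraMap_injective _ _).2
      (transcendental_iff_injective.1 hxF)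
    have : Algebra.IsAlgebraic k[X] F := by
      have hb : IsTranscendenceBasis k fun _ : Unit => algebraMap R F x := by
        refine AlgebraicIndependent.isTranscendenceBasis_of_lift_trdeg_le_of_finite
          (algebraicIndependent_unique_type_iff.2 hxF) ?_
        simp [htr]
      have := hb.isAlgebraic
      refine Algebra.IsAlgebraic.of_ringHom_of_comp_eq
        (S := Algebra.adjoin k (Set.range fun _ : Unit => algebraMap R F x)) (B := F)
        ((aeval (algebraMap R F x) : k[X] →ₐ[k] F).codRestrict _ fun p => ?_) (RingHom.id F)
        ?_ Function.injective_id ?_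
      · rw [Set.range_const]
        exact aeval_mem_adjoin_singleton k _
      · rintro ⟨a, ha⟩
        rw [Set.range_const, Algebra.adjoin_singleton_eq_range_aeval] at ha
        obtain ⟨p, rfl⟩ := ha
        exact ⟨p, rfl⟩
      · rfl
    let : Algebra (FractionRing k[X]) F := FractionRing.liftAlgebra k[X] F
    have : Algebra.IsAlgebraic (FractionRing k[X]) F :=
      Algebra.IsAlgebraic.extendScalars (R := k[X]) (IsFractionRing.injective _ _)
    have : IsScalarTower k (FractionRing k[X]) F := .of_algebraMap_eq fun c => by
      rw [IsScalarTower.algebraMap_apply k k[X] (FractionRing k[X]),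
        ← IsScalarTower.algebraMap_apply k[X] (FractionRing k[X]) F,
        ← IsScalarTower.algebraMap_apply k k[X] F]
    have : Algebra.EssFiniteType (FractionRing k[X]) F :=
      Algebra.EssFiniteType.of_comp k (FractionRing k[X]) F
    have : FiniteDimensional (FractionRing k[X]) F := Algebra.finite_of_essFiniteType_of_isAlgebraic
    rw [← Module.rank_lt_aleph0_iff]
    refine (rank_le (n := Module.finrank (FractionRing k[X]) F) fun s hs => ?_).trans_lt
      (natCast_lt_aleph0)
    choose y hy using fun i : s => Ideal.Quotient.mk_surjective (i : R ⧸ Ideal.span {x})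
    have hli : LinearIndependent k[X] fun i => algebraMap R F (y i) := by
      refine Fintype.linearIndependent_iff.2 fun f hf i => ?_
      refine Polynomial.ext fun n => X_pow_dvd_iff.1 (?_ : X ^ (n + 1) ∣ f i) n n.lt_succ_self
      refine X_pow_dvd_of_sum_aeval_mul_eq_zero hx (y := y) (by simpa only [hy] using hs) _ f
        (hinj ?_) i
      rw [map_zero, ← hf, map_sum]
      exact Finset.sum_congr rfl fun i _ => by rw [map_mul, Algebra.smul_def, hmap]
    have := (LinearIndependent.iff_fractionRing k[X] (FractionRing k[X])).1 hli
    simpa using this.fintype_card_le_finrank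

theorem hasFiniteQuotients_of_ratFunc [Finite k] [FiniteDimensional (RatFunc k) F] (R : Type*)
    [CommRing R] [IsDomain R] [Algebra R F] [FaithfulSMul R F] [Algebra k R]
    [IsScalarTower k R F] : Ring.HasFiniteQuotients R where
  finiteQuotient {I} hI := by
    obtain ⟨x, hxI, hx⟩ := Submodule.exists_mem_ne_zero_of_ne_bot hI
    have := finite_quotient_span_singleton (k := k) (F := F) hx
    have : Finite (R ⧸ Ideal.span {x}) := Module.finite_of_finite k
    exact Finite.of_surjective _
      (Ideal.Quotient.factor_surjective ((Ideal.span_singleton_le_iff_mem I).2 hxI))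

end FunctionField

/-! ### Traces at tame primes -/

section Trace

open scoped Pointwise

theorem exists_sum_algEquiv_apply_ne_zero {D l L : Type*} [Group D] [Fintype D] [CommRing l]
    [CommRing L] [IsDomain L] [Algebra l L] (h : D →* (L ≃ₐ[l] L))
    (hker : (Nat.card h.ker : L) ≠ 0) : ∃ z : L, ∑ d, h d z ≠ 0 := by
  classical
  by_contra! hzero
  let χ : D → (L →* L) := fun d => (h d : L →* L)
  have hli := linearIndependent_iff'.1 (linearIndependent_monoidHom L L) (Finset.univ.image χ)
    (fun f => ((Finset.univ.filter fun d => χ d = f).card : L)) (by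
      have := Finset.sum_comp (s := Finset.univ) (fun f : L →* L => (f : L → L)) χ
      refine (Eq.trans ?_ this.symm).trans ?_
      · exact Finset.sum_congr rfl fun f _ => Nat.cast_smul_eq_nsmul L _ _
      · funext z
        rw [Finset.sum_apply]
        exact hzero z) (χ 1) (Finset.mem_image_of_mem _ (Finset.mem_univ _))
  refine hker ?_
  rw [← hli, Nat.card_eq_fintype_card, Fintype.card_subtype]
  congr 2
  ext d
  simp only [Finset.mem_filter, Finset.mem_univ, true_and, MonoidHom.mem_ker, χ]
  constructor
  · intro hd
    rw [hd, map_one]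
  · intro hd
    ext z
    rw [← map_one h]
    exact DFunLike.congr_fun hd z

/-- If the order of the inertia group of a prime `w` above `v` is prime to the residue
characteristic, then some trace is a unit at `v`: modulo `w`, the trace of an element supported at
`w` is the sum over the decomposition group of the automorphisms it induces on the residue field,
where each of them occurs once for every element of the inertia group. -/
theorem exists_sum_smul_notMem {R S G : Type*} [CommRing R] [CommRing S] [Algebra R S] [Group G]
    [Fintype G] [MulSemiringAction G S] [SMulCommClass G R S] (p : Ideal R) (P : Ideal S)
    [P.IsMaximal] [P.LiesOver p] (hI : ((Nat.card (P.inertia G) : ℕ) : S ⧸ P) ≠ 0) :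
    ∃ y : S, ∑ g : G, g • y ∉ P := by
  classical
  let D := MulAction.stabilizer G P
  let h := Ideal.Quotient.stabilizerHom P p G
  have hker : Nat.card h.ker = Nat.card (P.inertia G) := by
    rw [Ideal.Quotient.ker_stabilizerHom, ← Nat.card_congr (Subgroup.subgroupOfEquivOfLe
      (Ideal.inertia_le_stabilizer (M := G) P)).toEquiv, AddSubgroup.subgroupOf_inertia]
  obtain ⟨z, hz⟩ := exists_sum_algEquiv_apply_ne_zero h (by rwa [hker])
  obtain ⟨c, hc, hcP⟩ : ∃ c : S, (∀ g : G, g • P ≠ P → g • c ∈ P) ∧ c ∉ P := by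
    let s : Finset (Ideal S) := (Finset.univ.image fun g : G => g • P).erase P
    have hs : ¬ ∏ Q ∈ s, Q ≤ P := fun hle => by
      obtain ⟨Q, hQ, hQP⟩ := (Ideal.IsPrime.prod_le inferInstance).1 hle
      obtain ⟨hne, g, rfl⟩ := by simpa [s] using hQ
      rw [Ideal.pointwise_smul_subset_iff] at hQP
      have := (inferInstance : P.IsMaximal).eq_of_le (Ideal.IsPrime.ne_top inferInstance) hQP
      exact hne (by rw [← eq_inv_smul_iff, ← this])
    obtain ⟨c, hc, hcP⟩ := SetLike.not_le_iff_exists.1 hs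
    refine ⟨c, fun g hg => ?_, hcP⟩
    rw [← Ideal.mem_inv_pointwise_smul_iff]
    refine (Ideal.prod_le_inf.trans (Finset.inf_le (f := fun Q : Ideal S => Q) ?_)) hc
    refine Finset.mem_erase.2 ⟨fun h => hg ?_, Finset.mem_image_of_mem _ (Finset.mem_univ _)⟩
    exact (inv_smul_eq_iff.1 h).symm
  obtain ⟨z₀, rfl⟩ := Ideal.Quotient.mk_surjective z
  obtain ⟨b, i, hi, hb⟩ := (inferInstance : P.IsMaximal).exists_inv hcP
  refine ⟨c * (b * z₀), fun hy => hz ?_⟩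
  rw [← Ideal.Quotient.eq_zero_iff_mem, map_sum] at hy
  have hw : Ideal.Quotient.mk P (c * (b * z₀)) = Ideal.Quotient.mk P z₀ := by
    rw [Ideal.Quotient.eq, show c * (b * z₀) - z₀ = -(z₀ * i) by linear_combination z₀ * hb]
    exact P.neg_mem (P.mul_mem_left _ hi)
  rw [← hy, ← Finset.sum_subset (Finset.subset_univ (Finset.univ.filter fun g : G => g ∈ D)),
    Finset.sum_subtype _ (p := fun g => g ∈ D) (by simp)]
  · refine Finset.sum_congr rfl fun d _ => ?_
    rw [← hw]
    rfl
  · intro g _ hg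
    rw [Ideal.Quotient.eq_zero_iff_mem, smul_mul']
    exact P.mul_mem_right _ (hc g fun h => hg (by simpa [D] using h))

theorem faithfulSMul_integralClosure (R F K : Type*) [CommRing R] [Field F] [Field K] [Algebra R F]
    [IsFractionRing R F] [Algebra F K] [Algebra R K] [IsScalarTower R F K] :
    FaithfulSMul R (integralClosure R K) :=
  (faithfulSMul_iff_algebraMap_injective _ _).2 <| by
    refine Function.Injective.of_comp (f := algebraMap (integralClosure R K) K) ?_
    rw [← RingHom.coe_comp, ← IsScalarTower.algebraMap_eq, IsScalarTower.algebraMap_eq R F K]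
    exact (algebraMap F K).injective.comp (IsFractionRing.injective R F)

/-- The trace from the integral closure is surjective locally at a tame prime. -/
theorem IsTameAt.exists_trace_notMem {R F K : Type*} [CommRing R] [IsDedekindDomain R]
    [Ring.HasFiniteQuotients R] [Field F] [Field K] [Algebra R F] [IsFractionRing R F]
    [Algebra F K] [Algebra R K] [IsScalarTower R F K] [FiniteDimensional F K] [IsGalois F K]
    {v : HeightOneSpectrum R} (hv : IsTameAt R K v) :
    ∃ (y : integralClosure R K) (u : R), u ∉ v.asIdeal ∧
      ∑ g : Gal(K/F), g • y = algebraMap R (integralClosure R K) u := by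
  have : IsFractionRing (integralClosure R K) K :=
    integralClosure.isFractionRing_of_finite_extension F K
  have : Module.Finite R (integralClosure R K) := IsIntegralClosure.finite R F K _
  have : IsGaloisGroup Gal(K/F) R (integralClosure R K) := IsGaloisGroup.of_isFractionRing _ _ _ F K
  have : FaithfulSMul R (integralClosure R K) := faithfulSMul_integralClosure R F K
  have : IsDedekindDomain (integralClosure R K) := integralClosure.isDedekindDomain R F K
  have : Finite (R ⧸ v.asIdeal) := Ring.HasFiniteQuotients.finiteQuotient v.ne_bot
  obtain ⟨w, hw⟩ := (inferInstance : Nonempty (v.asIdeal.primesOver (integralClosure R K)))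
  obtain ⟨_, _⟩ := hw
  have : w.IsMaximal := Ideal.IsMaximal.of_liesOver_isMaximal w v.asIdeal
  have hcard : Nat.card (w.inertia Gal(K/F)) = w.ramificationIdx R := by
    rw [Ideal.card_inertia_eq_ramificationIdxIn v.asIdeal w,
      Ideal.ramificationIdxIn_eq_ramificationIdx v.asIdeal w Gal(K/F)]
  obtain ⟨y, hy⟩ := exists_sum_smul_notMem (G := Gal(K/F)) v.asIdeal w (by
    rw [hcard, ← map_natCast (algebraMap (R ⧸ v.asIdeal) (integralClosure R K ⧸ w)), Ne,
      map_eq_zero_iff _ (FaithfulSMul.algebraMap_injective _ _), ringChar.spec]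
    exact (hv w).1)
  obtain ⟨u, hu⟩ := Algebra.IsInvariant.isInvariant (A := R) (G := Gal(K/F))
    (∑ g : Gal(K/F), g • y) fun g => by
      rw [Finset.smul_sum]
      simp only [smul_smul]
      exact Fintype.sum_equiv (Equiv.mulLeft g) _ _ fun _ => rfl
  refine ⟨y, u, fun huv => hy ?_, hu.symm⟩
  rw [← hu]
  exact (Ideal.mem_of_liesOver w v.asIdeal u).1 huv

end Trace

/-! ### Projective modules over group rings -/

section GroupRing

/-- **Higman's criterion**: an `R[G]`-module that is projective over `R` is projective over `R[G]`
as soon as its identity is a sum of conjugates of an `R`-linear endomorphism. -/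
theorem projective_of_sumOfConjugates_eq {R G V : Type*} [CommRing R] [Group G] [Fintype G]
    [AddCommGroup V] [Module R V] [Module R[G] V] [IsScalarTower R R[G] V] [Module.Projective R V]
    (φ : V →ₗ[R] V) (hφ : ∀ x, φ.sumOfConjugates G x = x) : Module.Projective R[G] V := by
  let π : (V →₀ R[G]) →ₗ[R[G]] V := Finsupp.linearCombination R[G] id
  have hπ : Function.Surjective π := Finsupp.linearCombination_id_surjective R[G] V
  obtain ⟨s, hs⟩ := Module.projective_lifting_property (π.restrictScalars R) LinearMap.id hπ
  refine Module.Projective.of_split ((s ∘ₗ φ).sumOfConjugatesEquivariant G) π ?_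
  ext x
  rw [LinearMap.comp_apply, LinearMap.sumOfConjugatesEquivariant_apply, map_sum, LinearMap.id_apply]
  conv_rhs => rw [← hφ x, LinearMap.sumOfConjugates_apply]
  refine Finset.sum_congr rfl fun g _ => ?_
  rw [LinearMap.conjugate_apply, LinearMap.conjugate_apply, map_smul]
  exact congrArg _ (LinearMap.congr_fun hs _)

theorem Representation.projective_asModule_of_sum_eq {R G N : Type*} [CommRing R] [Group G]
    [Fintype G] [AddCommGroup N] [Module R N] [Module.Projective R N] (ρ : Representation R G N)
    (φ : N →ₗ[R] N) (hφ : ∀ x, ∑ g, ρ g⁻¹ (φ (ρ g x)) = x) :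
    Module.Projective R[G] ρ.asModule := by
  have : Module.Projective R ρ.asModule := .of_equiv ρ.asModuleEquiv.symm
  refine projective_of_sumOfConjugates_eq (V := ρ.asModule)
    (ρ.asModuleEquiv.symm.toLinearMap ∘ₗ φ ∘ₗ ρ.asModuleEquiv.toLinearMap) fun x => ?_
  rw [LinearMap.sumOfConjugates_apply]
  refine Eq.trans (Finset.sum_congr rfl fun g _ => ?_) (hφ x)
  rw [LinearMap.conjugate_apply, Representation.single_smul, Representation.single_smul, one_smul,
    one_smul]
  rfl

/-- A finite flat module over a flat algebra `A` over a domain `R` that becomes free of rank one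
after inverting a nonzero element of `R` has rank one everywhere, since every prime ideal of `A`
contains a prime ideal lying over `0`. -/
theorem rankAtStalk_eq_one_of_smul_mem_range {R A V : Type*} [CommRing R] [IsDomain R] [CommRing A]
    [Algebra R A] [Module.Flat R A] [AddCommGroup V] [Module A V] [Module.Finite A V]
    [Module.Flat A V] (f : A →ₗ[A] V) (hf : Function.Injective f) {r : R} (hr : r ≠ 0)
    (h : ∀ x : V, algebraMap R A r • x ∈ LinearMap.range f) (P : PrimeSpectrum A) :
    Module.rankAtStalk V P = 1 := by
  obtain ⟨Q, hQP, hQ, hQR⟩ := Ideal.exists_ideal_le_liesOver_of_le (p := (⊥ : Ideal R))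
    (q := P.asIdeal.under R) P.asIdeal bot_le
  rw [← Module.rankAtStalk_eq_of_le_of_finite_of_flat V (p := ⟨Q, hQ⟩) (q := P) hQP]
  have hrQ : algebraMap R A r ∈ Q.primeCompl := fun h => hr <| by
    simpa using (Ideal.mem_of_liesOver Q (⊥ : Ideal R) r).2 h
  have hbij : Function.Bijective (LocalizedModule.map Q.primeCompl f) := by
    refine ⟨LocalizedModule.map_injective _ f hf, fun x => ?_⟩
    induction x using LocalizedModule.induction_on with
    | h x s =>
      obtain ⟨a, ha⟩ := h x
      refine ⟨LocalizedModule.mk a (⟨_, hrQ⟩ * s), ?_⟩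
      rw [LocalizedModule.map_mk, ha]
      exact LocalizedModule.mk_cancel_common_left ⟨_, hrQ⟩ s x
  have : Nontrivial A := ⟨0, 1, fun h => hQ.ne_top ((Ideal.eq_top_iff_one _).2 (h ▸ Q.zero_mem))⟩
  have hA : Module.rankAtStalk A (⟨Q, hQ⟩ : PrimeSpectrum A) = 1 :=
    congrFun (Module.rankAtStalk_self (R := A)) _
  rw [← hA]
  exact (LinearEquiv.ofBijective _ hbij).finrank_eq.symm

/-- A projective module of constant rank one becomes free of rank one modulo an ideal with finite
quotient, since finite rings are semilocal. -/
theorem nonempty_quotient_linearEquiv_of_rankAtStalk_eq_one {A V : Type*} [CommRing A]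
    [AddCommGroup V] [Module A V] [Module.Finite A V] [Module.Flat A V]
    (hV : ∀ P : PrimeSpectrum A, Module.rankAtStalk V P = 1) (J : Ideal A) [Finite (A ⧸ J)] :
    Nonempty ((V ⧸ (J • ⊤ : Submodule A V)) ≃ₗ[A] A ⧸ J) := by
  have hfree : Nonempty (Module.Basis (Fin 1) (A ⧸ J) ((A ⧸ J) ⊗[A] V)) := by
    refine Module.nonempty_basis_of_flat_of_finrank_eq _ _ 1 fun P => ?_
    let := Ideal.Quotient.field P.1
    let p : PrimeSpectrum ((A ⧸ J) ⧸ P.1) := ⊥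
    have h := Module.rankAtStalk_baseChange (R := A ⧸ J) (M := (A ⧸ J) ⊗[A] V) p
    rw [Module.rankAtStalk_eq_finrank_of_free] at h
    exact h.trans ((Module.rankAtStalk_baseChange _).trans (hV _))
  obtain ⟨b⟩ := hfree
  exact ⟨(TensorProduct.quotTensorEquivQuotSMul V J).symm ≪≫ₗ
    (b.equivFun ≪≫ₗ LinearEquiv.funUnique (Fin 1) (A ⧸ J) (A ⧸ J)).restrictScalars A⟩

theorem natCard_quotient_map_algebraMap {R A ι : Type*} [CommRing R] [CommRing A] [Algebra R A]
    [Finite ι] (b : Module.Basis ι R A) (v : Ideal R) :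
    Nat.card (A ⧸ v.map (algebraMap R A)) = Nat.card (R ⧸ v) ^ Nat.card ι := by
  have e₁ := (TensorProduct.quotTensorEquivQuotSMul A v).toEquiv
  have e₂ := (b.baseChange (R ⧸ v)).equivFun.toEquiv
  rw [Ideal.smul_top_eq_map] at e₁
  have e₃ := (Submodule.Quotient.restrictScalarsEquiv R (v.map (algebraMap R A))).toEquiv
  rw [Nat.card_congr (e₃.symm.trans (e₁.symm.trans e₂)), Nat.card_fun]

end GroupRing

section Fiber

/-- The submodules `JV`, for the ideal `J` of `R[G]` generated by `v`, and `vN` agree. -/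
theorem mem_map_smul_top_iff {R G N : Type*} [CommRing R] [Group G] [IsMulCommutative G]
    [AddCommGroup N] [Module R N] {ρ : Representation R G N} (v : Ideal R) (x : N) :
    ρ.asModuleEquiv.symm x ∈ (v.map (algebraMap R R[G]) • ⊤ : Submodule R[G] ρ.asModule) ↔
      x ∈ (v • ⊤ : Submodule R N) := by
  have h := Ideal.smul_restrictScalars v (⊤ : Submodule R[G] ρ.asModule)
  rw [← Submodule.restrictScalars_mem R, h]
  rfl

/-- The fibre at `v` of a projective `R[G]`-module of rank one is free over `k[G]`. It is cyclic
over `R[G]`, so that lifts to `R` of a `k`-basis of `R/v` provide generators over `k[G]`, and there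
are no relations between them because the cardinalities agree. -/
theorem nonempty_fiber_linearEquiv {k R G N : Type*} [Field k] [Finite k] [CommRing R]
    [Algebra k R] [Group G] [Finite G] [IsMulCommutative G] [AddCommGroup N] [Module R N]
    [Module k N] [IsScalarTower k R N] {ρ : Representation R G N} [Module.Finite R N]
    [Module.Projective R[G] ρ.asModule]
    (hρ : ∀ P : PrimeSpectrum R[G], Module.rankAtStalk ρ.asModule P = 1) (v : Ideal R)
    [Module.Finite k (R ⧸ v)] :
    Nonempty ((ModFiber.rep k ρ v).asModule ≃ₗ[k[G]]
      (Fin (Module.finrank k (R ⧸ v)) → k[G])) := by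
  have : Finite (R ⧸ v) := Module.finite_of_finite k
  let J : Ideal R[G] := v.map (algebraMap R R[G])
  have hJ := natCard_quotient_map_algebraMap (MonoidAlgebra.basis G R) v
  have : Finite (R[G] ⧸ J) := Nat.finite_of_card_ne_zero (hJ ▸ pow_ne_zero _ Nat.card_pos.ne')
  have : Module.Finite R[G] ρ.asModule := Module.Finite.of_restrictScalars_finite R _ _
  obtain ⟨e⟩ := nonempty_quotient_linearEquiv_of_rankAtStalk_eq_one hρ J
  let W := (ModFiber.rep k ρ v).asModule
  have hW : Nat.card W = Nat.card (R ⧸ v) ^ Nat.card G := by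
    refine (Nat.card_congr ?_).trans hJ
    refine Equiv.trans (?_ : W ≃ (ρ.asModule ⧸ (J • ⊤ : Submodule R[G] ρ.asModule))) e.toEquiv
    refine Quotient.congr ρ.asModuleEquiv.symm.toEquiv fun x y => ?_
    rw [Submodule.quotientRel_def, Submodule.quotientRel_def, ← mem_map_smul_top_iff (ρ := ρ)]
    rfl
  obtain ⟨m, hm⟩ := Submodule.Quotient.mk_surjective _ (e.symm 1)
  have hgen : ∀ x : N, ∃ a : R[G], x - ρ.asModuleEquiv (a • m) ∈ (v • ⊤ : Submodule R N) := by
    intro x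
    obtain ⟨a, ha⟩ := Ideal.Quotient.mk_surjective
      (e (Submodule.Quotient.mk (ρ.asModuleEquiv.symm x)))
    refine ⟨a, ?_⟩
    rw [← mem_map_smul_top_iff (ρ := ρ), map_sub, LinearEquiv.symm_apply_apply,
      ← Submodule.Quotient.eq, Submodule.Quotient.mk_smul, hm, ← map_smul, LinearEquiv.eq_symm_apply,
      ← ha]
    exact congrArg _ (mul_one a).symm
  let b := Module.finBasis k (R ⧸ v)
  choose β hβ using fun i => Ideal.Quotient.mk_surjective (b i)
  let q : N →ₗ[k] W := (ModFiber.rep k ρ v).asModuleEquiv.symm.toLinearMap ∘ₗ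
    ((v • ⊤ : Submodule R N).mkQ.restrictScalars k)
  have hq : ∀ x ∈ (v • ⊤ : Submodule R N), q x = 0 := fun x hx =>
    (Submodule.Quotient.mk_eq_zero _).2 hx
  let Ψ : (Fin (Module.finrank k (R ⧸ v)) → k[G]) →ₗ[k[G]] W :=
    Fintype.linearCombination k[G] fun i => (q (β i • ρ.asModuleEquiv m) : W)
  have hmem : ∀ a : R[G], q (ρ.asModuleEquiv (a • m)) ∈ LinearMap.range Ψ := by
    intro a
    induction a using MonoidAlgebra.induction_linear with
    | zero => simp
    | add a a' ha ha' =>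
      rw [add_smul, map_add, map_add]
      exact add_mem ha ha'
    | single g r =>
      refine ⟨fun i => MonoidAlgebra.single g (b.repr (Ideal.Quotient.mk v r) i), ?_⟩
      have hr : r - ∑ i, b.repr (Ideal.Quotient.mk v r) i • β i ∈ v := by
        rw [← Ideal.Quotient.eq, map_sum]
        conv_lhs => rw [← b.sum_repr (Ideal.Quotient.mk v r)]
        refine Finset.sum_congr rfl fun i _ => ?_
        rw [← hβ]
        rfl
      have h := hq _ (Submodule.smul_mem_smul hr
        (Submodule.mem_top (x := ρ g (ρ.asModuleEquiv m))))
      rw [sub_smul, map_sub, sub_eq_zero, Finset.sum_smul, map_sum] at h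
      rw [Representation.single_smul]
      refine Eq.trans ?_ h.symm
      rw [Fintype.linearCombination_apply]
      refine Finset.sum_congr rfl fun i _ => ?_
      rw [smul_assoc, LinearMap.map_smul q, ← LinearMap.map_smul (ρ g)]
      exact Representation.single_smul (ModFiber.rep k ρ v) _ _ _
  have hΨ : Function.Surjective Ψ := by
    intro w
    obtain ⟨x, rfl⟩ : ∃ x, q x = w := Submodule.Quotient.mk_surjective _ w
    obtain ⟨a, ha⟩ := hgen x
    have h := hq _ ha
    rw [map_sub, sub_eq_zero] at h
    rw [h]
    exact hmem a
  have hcard : Nat.card (Fin (Module.finrank k (R ⧸ v)) → k[G]) = Nat.card W := by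
    have e := (MonoidAlgebra.basis G k).equivFun.toEquiv
    rw [hW, Nat.card_fun, Nat.card_congr e, Nat.card_fun, Nat.card_congr b.equivFun.toEquiv,
      Nat.card_fun, ← pow_mul, ← pow_mul, mul_comm]
  have : Finite W := Nat.finite_of_card_ne_zero (hW ▸ pow_ne_zero _ Nat.card_pos.ne')
  have : Finite (Fin (Module.finrank k (R ⧸ v)) → k[G]) :=
    Nat.finite_of_card_ne_zero (hcard ▸ hW ▸ pow_ne_zero _ Nat.card_pos.ne')
  exact ⟨(LinearEquiv.ofBijective Ψ ((Nat.bijective_iff_surjective_and_card Ψ).2 ⟨hΨ, hcard⟩)).symm⟩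

end Fiber

/-! ### Completions and localization at a prime -/

section Completion

variable {R : Type*} (F : Type*) [CommRing R] [IsDedekindDomain R] [Field F] [Algebra R F]
  [IsFractionRing R F] (v : HeightOneSpectrum R)

theorem isUnit_algebraMap_adicCompletionIntegers_iff (r : R) :
    IsUnit (algebraMap R (v.adicCompletionIntegers F) r) ↔ r ∉ v.asIdeal := by
  rw [← v.valuation_eq_one_iff_notMem (K := F), ← v.valuedAdicCompletion_eq_valuation]
  exact (Valuation.integer.integers
    (Valued.v (R := v.adicCompletion F))).isUnit_iff_valuation_eq_one

/-- The residue map `R → R/v` embeds into the residue field of the completion, so that the fibre of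
a module at `v` is detected after tensoring with the completion. -/
theorem smul_top_eq_top_of_subsingleton_tensorProduct {Q : Type*} [AddCommGroup Q] [Module R Q]
    (h : Subsingleton (Q ⊗[R] v.adicCompletionIntegers F)) :
    (v.asIdeal • ⊤ : Submodule R Q) = ⊤ := by
  by_contra hQ
  let := Ideal.Quotient.field v.asIdeal
  have : Nontrivial (Q ⧸ (v.asIdeal • ⊤ : Submodule R Q)) := Submodule.Quotient.nontrivial_iff.2 hQ
  obtain ⟨x, hx⟩ := exists_ne (0 : Q ⧸ (v.asIdeal • ⊤ : Submodule R Q))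
  obtain ⟨φ, hφ⟩ : ∃ φ : Module.Dual (R ⧸ v.asIdeal) (Q ⧸ (v.asIdeal • ⊤ : Submodule R Q)),
      φ x ≠ 0 := by
    by_contra! h
    exact hx ((Module.forall_dual_apply_eq_zero_iff (R ⧸ v.asIdeal) x).1 h)
  let κ := IsLocalRing.ResidueField (v.adicCompletionIntegers F)
  let j : (R ⧸ v.asIdeal) →ₐ[R] κ := Ideal.Quotient.liftₐ v.asIdeal (Algebra.ofId R κ) fun a ha => by
    refine (IsLocalRing.residue_eq_zero_iff _).2 ((IsLocalRing.mem_maximalIdeal _).2 fun hu => ?_)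
    exact (isUnit_algebraMap_adicCompletionIntegers_iff F v a).1 hu ha
  obtain ⟨q, rfl⟩ := Submodule.Quotient.mk_surjective _ x
  let f : Q →ₗ[R] κ := j.toLinearMap ∘ₗ φ.restrictScalars R ∘ₗ Submodule.mkQ _
  let β : Q ⊗[R] v.adicCompletionIntegers F →ₗ[R] κ :=
    LinearMap.mul' R κ ∘ₗ TensorProduct.map f (IsScalarTower.toAlgHom R _ κ).toLinearMap
  have h0 : β (q ⊗ₜ 1) = 0 := by rw [Subsingleton.elim (q ⊗ₜ[R] 1) 0, map_zero]
  have h1 : β (q ⊗ₜ 1) = j (φ (Submodule.Quotient.mk q)) := by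
    simp [β, f]
  rw [h1] at h0
  exact hφ ((map_eq_zero_iff j j.toRingHom.injective).1 h0)

theorem subsingleton_tensorProduct_adicCompletionIntegers {Q : Type*} [AddCommGroup Q] [Module R Q]
    {s : R} (hs : s ∉ v.asIdeal) (h : ∀ q : Q, s • q = 0) :
    Subsingleton (Q ⊗[R] v.adicCompletionIntegers F) := by
  obtain ⟨t, ht⟩ := ((isUnit_algebraMap_adicCompletionIntegers_iff F v s).2 hs).exists_right_inv
  refine subsingleton_of_forall_eq 0 fun x => ?_
  induction x using TensorProduct.induction_on with
  | zero => rfl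
  | add x y hx hy => rw [hx, hy, add_zero]
  | tmul q o =>
    have : o = s • (t * o) := by rw [Algebra.smul_def, ← mul_assoc, ht, one_mul]
    rw [this, ← TensorProduct.smul_tmul, h, TensorProduct.zero_tmul]

end Completion

/-! ### Comparison of taming modules with the integral closure -/

section TamingModule

variable {k R F K : Type*} [CommRing R] [IsDedekindDomain R] [Field F] [Field K]
  [Algebra R F] [IsFractionRing R F] [Algebra F K] [Algebra R K] [IsScalarTower R F K]
  [FiniteDimensional F K] [IsAbelianGalois F K] {M : TauGSubmodule k R F K}

theorem IsTamingModule.exists_smul_mem (hM : IsTamingModule M) {v : HeightOneSpectrum R}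
    (hv : IsTameAt R K v) :
    ∃ s : R, s - 1 ∈ v.asIdeal ∧ ∀ x : integralClosure R K, s • x ∈ M.toSubmodule := by
  have : Module.Finite R (integralClosure R K) := IsIntegralClosure.finite R F K _
  obtain ⟨s, hs, h⟩ := Submodule.exists_sub_one_mem_and_smul_eq_zero_of_fg_of_le_smul v.asIdeal
    (⊤ : Submodule R (integralClosure R K ⧸ M.toSubmodule)) Module.Finite.fg_top
    (smul_top_eq_top_of_subsingleton_tensorProduct F v (hM.quotient_tensor_eq_zero v hv)).ge
  refine ⟨s, hs, fun x => ?_⟩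
  rw [← Submodule.Quotient.mk_eq_zero, Submodule.Quotient.mk_smul]
  exact h _ trivial

theorem IsTamingModule.bijective_map_subtype (hM : IsTamingModule M) {v : HeightOneSpectrum R}
    (hv : IsTameAt R K v) : Function.Bijective (ModFiber.map v.asIdeal M.toSubmodule.subtype) := by
  obtain ⟨s, hs, h⟩ := hM.exists_smul_mem hv
  have key : ∀ {N : Type _} [AddCommGroup N] [Module R N] (x : N),
      x - s • x ∈ v.asIdeal • (⊤ : Submodule R N) := fun x => by
    rw [← one_smul R x, smul_smul, mul_one, ← sub_smul]
    refine Submodule.smul_mem_smul ?_ trivial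
    simpa using v.asIdeal.neg_mem hs
  constructor
  · rw [injective_iff_map_eq_zero]
    intro x hx
    obtain ⟨x, rfl⟩ := Submodule.Quotient.mk_surjective _ x
    rw [ModFiber.map_mk, Submodule.Quotient.mk_eq_zero] at hx
    rw [Submodule.Quotient.mk_eq_zero]
    let σ : integralClosure R K →ₗ[R] M.toSubmodule :=
      (LinearMap.lsmul R _ s).codRestrict M.toSubmodule h
    have hσ : s • x ∈ v.asIdeal • (⊤ : Submodule R M.toSubmodule) :=
      smul_top_le_comap_smul_top v.asIdeal σ hx
    simpa using add_mem (key x) hσ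
  · intro x
    obtain ⟨x, rfl⟩ := Submodule.Quotient.mk_surjective _ x
    refine ⟨Submodule.Quotient.mk ⟨s • x, h x⟩, ?_⟩
    rw [ModFiber.map_mk]
    exact ((Submodule.Quotient.eq _).2 (key x)).symm

/-- The annihilator of `S/M` lies in no nonzero prime ideal, and it is nonzero because `S/M` is
finite while `R` is infinite; the latter matters only when `R` is a field. -/
theorem IsTamingModule.toSubmodule_eq_top [Infinite R] (hM : IsTamingModule M)
    (h : ∀ v : HeightOneSpectrum R, IsTameAt R K v) : M.toSubmodule = ⊤ := by
  let Q := integralClosure R K ⧸ M.toSubmodule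
  have := hM.finite_quotient
  by_contra hne
  have hann : Module.annihilator R Q ≠ ⊤ := fun htop => hne <| by
    rw [← Submodule.Quotient.subsingleton_iff]
    exact Module.annihilator_eq_top_iff.1 htop
  obtain ⟨m, hm, hle⟩ := Ideal.exists_le_maximal _ hann
  have hbot : Module.annihilator R Q ≠ ⊥ := fun hbot => by
    have hinj : Function.Injective (fun (r : R) (q : Q) => r • q) := fun r r' hr => by
      have : r - r' ∈ Module.annihilator R Q := Module.mem_annihilator.2 fun q => by
        rw [sub_smul, sub_eq_zero]
        exact congrFun hr q
      rwa [hbot, Ideal.mem_bot, sub_eq_zero] at this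
    exact not_finite_iff_infinite.2 ‹Infinite R› (Finite.of_injective _ hinj)
  obtain ⟨s, hs, hsM⟩ := hM.exists_smul_mem
    (h ⟨m, hm.isPrime, fun h0 => hbot (le_bot_iff.1 (h0 ▸ hle))⟩)
  have hsm : s ∈ m := hle <| Module.mem_annihilator.2 fun q => by
    obtain ⟨x, rfl⟩ := Submodule.Quotient.mk_surjective _ q
    exact (Submodule.Quotient.mk_eq_zero _).2 (hsM x)
  exact hm.ne_top ((Ideal.eq_top_iff_one _).2 (by simpa using m.sub_mem hsm hs))

/-- The fibres of a taming module are free over `k[G]`. -/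
theorem IsTamingModule.nonempty_fiberAsModule_linearEquiv [Field k] [Finite k] [Algebra k R]
    [Algebra k K] [IsScalarTower k R K] (hM : IsTamingModule M) (v : Ideal R)
    [Module.Finite k (R ⧸ v)] :
    Nonempty (M.FiberAsModule v ≃ₗ[k[Gal(K/F)]]
      (Fin (Module.finrank k (R ⧸ v)) → k[Gal(K/F)])) := by
  have : Module.Finite R (integralClosure R K) := IsIntegralClosure.finite R F K _
  have := hM.projective
  exact nonempty_fiber_linearEquiv hM.rank_eq_one v

end TamingModule

/-! ### Frobenius-stable lattices spanned by a normal basis -/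

section Denominators

/-- A finitely generated submodule that is carried into `N` elementwise by elements of a
multiplicative set is carried into `N` by a single element of it. -/
theorem Submodule.FG.exists_forall_smul_mem {R V : Type*} [CommRing R] [AddCommGroup V] [Module R V]
    {L : Submodule R V} (hL : L.FG) (N : Submodule R V) (T : Submonoid R)
    (h : ∀ x ∈ L, ∃ t ∈ T, t • x ∈ N) : ∃ t ∈ T, ∀ x ∈ L, t • x ∈ N := by
  induction L, hL using Submodule.fg_induction with
  | singleton x =>
    obtain ⟨t, ht, htx⟩ := h x (Submodule.mem_span_singleton_self x)
    refine ⟨t, ht, fun y hy => ?_⟩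
    obtain ⟨r, rfl⟩ := Submodule.mem_span_singleton.1 hy
    rw [smul_comm]
    exact N.smul_mem r htx
  | sup L₁ L₂ _ _ ih₁ ih₂ =>
    obtain ⟨t₁, ht₁, h₁⟩ := ih₁ fun x hx => h x (Submodule.mem_sup_left hx)
    obtain ⟨t₂, ht₂, h₂⟩ := ih₂ fun x hx => h x (Submodule.mem_sup_right hx)
    refine ⟨t₁ * t₂, T.mul_mem ht₁ ht₂, fun x hx => ?_⟩
    obtain ⟨x₁, hx₁, x₂, hx₂, rfl⟩ := Submodule.mem_sup.1 hx
    rw [smul_add]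
    refine N.add_mem ?_ ?_
    · rw [mul_comm, mul_smul]
      exact N.smul_mem t₂ (h₁ x₁ hx₁)
    · rw [mul_smul]
      exact N.smul_mem t₁ (h₂ x₂ hx₂)

theorem Module.Basis.exists_smul_mem_span {R F K ι : Type*} [CommRing R] [IsDomain R] [Field F]
    [AddCommGroup K] [Algebra R F] [IsFractionRing R F] [Module F K] [Module R K]
    [IsScalarTower R F K] [Finite ι] (b : Module.Basis ι F K) (x : K) :
    ∃ r ∈ nonZeroDivisors R, r • x ∈ Submodule.span R (Set.range b) := by
  have := Fintype.ofFinite ι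
  classical
  obtain ⟨r, hr⟩ := IsLocalization.exist_integer_multiples_of_finset (nonZeroDivisors R)
    (Finset.univ.image (b.repr x))
  refine ⟨r, r.2, (b.mem_span_iff_repr_mem R _).2 fun i => ?_⟩
  obtain ⟨c, hc⟩ := hr (b.repr x i) (Finset.mem_image_of_mem _ (Finset.mem_univ i))
  refine ⟨c, hc.trans ?_⟩
  rw [← algebraMap_smul F (r : R) x, map_smul, Finsupp.smul_apply, algebraMap_smul]

end Denominators

section NormalBasis

variable (k R F K : Type*) [Field k] [Finite k] [CommRing R] [IsDomain R] [Field F] [Field K]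
  [Algebra R F] [IsFractionRing R F] [Algebra F K] [Algebra R K] [IsScalarTower R F K]
  [FiniteDimensional F K] [IsGalois F K]

/-- A normal basis of `K/F` may be scaled by an element of `R` so that its members are integral and
the `q`-th powers of its members lie in the `R`-lattice that it spans: if `dθ^q` lies in the lattice
spanned by the conjugates of `θ`, then `(dθ)^q = d^(q-1) (dθ^q)` lies in `d` times that lattice. -/
theorem exists_basis_pow_mem_span : ∃ b : Module.Basis Gal(K/F) F K, (∀ g, b g = g (b 1)) ∧
    IsIntegral R (b 1) ∧ b 1 ^ Nat.card k ∈ Submodule.span R (Set.range b) := by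
  have scale : ∀ (b : Module.Basis Gal(K/F) F K), (∀ g, b g = g (b 1)) → ∀ r ∈ nonZeroDivisors R,
      ∃ b' : Module.Basis Gal(K/F) F K, (∀ g, b' g = g (b' 1)) ∧ ∀ g, b' g = r • b g := by
    intro b hb r hr
    have hu : ∀ g : Gal(K/F), IsUnit (algebraMap R F r) := fun _ =>
      (IsFractionRing.to_map_ne_zero_of_mem_nonZeroDivisors hr).isUnit
    have hb' : ∀ g, b.isUnitSMul hu g = r • b g := fun g => by
      rw [Module.Basis.isUnitSMul_apply, algebraMap_smul]
    refine ⟨b.isUnitSMul hu, fun g => ?_, hb'⟩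
    rw [hb', hb', hb, ← algebraMap_smul F r (b 1), map_smul, algebraMap_smul]
  have : Algebra.IsAlgebraic R K := by
    have : Algebra.IsAlgebraic R F := IsLocalization.isAlgebraic _ (nonZeroDivisors R)
    exact Algebra.IsAlgebraic.trans R F K
  obtain ⟨r, hr, hint⟩ := (Algebra.IsAlgebraic.isAlgebraic (R := R)
    (IsGalois.normalBasis F K 1)).exists_integral_multiple
  obtain ⟨b, hb, hbr⟩ := scale _ IsGalois.normalBasis_apply r (mem_nonZeroDivisors_of_ne_zero hr)
  obtain ⟨d, hd, hdb⟩ := b.exists_smul_mem_span (R := R) (b 1 ^ Nat.card k)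
  obtain ⟨b', hb', hbd⟩ := scale b hb d hd
  refine ⟨b', hb', ?_, ?_⟩
  · rw [hbd, hbr]
    exact hint.smul d
  · have hmap : ∀ y ∈ Submodule.span R (Set.range b), d • y ∈ Submodule.span R (Set.range b') := by
      intro y hy
      induction hy using Submodule.span_induction with
      | mem y hy =>
        obtain ⟨g, rfl⟩ := hy
        exact hbd g ▸ Submodule.subset_span ⟨g, rfl⟩
      | zero => simp
      | add y z _ _ hy hz => exact smul_add d y z ▸ add_mem hy hz
      | smul c y _ hy => exact smul_comm c d y ▸ Submodule.smul_mem _ c hy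
    obtain ⟨n, hn⟩ := Nat.exists_eq_add_of_le (Finite.one_lt_card (α := k))
    rw [hbd, smul_pow]
    have : d ^ Nat.card k = d ^ n * d * d := by
      rw [hn]
      ring
    rw [this, mul_smul, mul_smul]
    exact Submodule.smul_mem _ _ (hmap _ hdb)

end NormalBasis

section NormalBasisLattice

variable {R F K : Type*} [CommRing R] [Field F] [Field K] [Algebra R F] [Algebra F K] [Algebra R K]
  [IsScalarTower R F K] {b : Module.Basis Gal(K/F) F K} (hb : ∀ g, b g = g (b 1))

include hb in
theorem gal_apply_mem_span_range {x : K} (hx : x ∈ Submodule.span R (Set.range b)) (g : Gal(K/F)) :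
    g x ∈ Submodule.span R (Set.range b) := by
  induction hx using Submodule.span_induction with
  | mem x hx =>
    obtain ⟨h, rfl⟩ := hx
    rw [hb h, ← AlgEquiv.mul_apply, ← hb]
    exact Submodule.subset_span ⟨_, rfl⟩
  | zero => simp
  | add x y _ _ hx hy => exact map_add g x y ▸ add_mem hx hy
  | smul r x _ hx =>
    rw [← algebraMap_smul F r x, map_smul, algebraMap_smul]
    exact Submodule.smul_mem _ r hx

include hb in
theorem isIntegral_of_mem_span_range (hint : IsIntegral R (b 1)) {x : K}
    (hx : x ∈ Submodule.span R (Set.range b)) : IsIntegral R x := by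
  refine Submodule.span_le.2 (?_ : _ ⊆ (Subalgebra.toSubmodule (integralClosure R K) : Set K)) hx
  rintro _ ⟨g, rfl⟩
  rw [hb g]
  exact hint.map (g.restrictScalars R)

include hb in
theorem pow_card_mem_span_range {k : Type*} [Field k] [Finite k] [Algebra k K]
    (hpow : b 1 ^ Nat.card k ∈ Submodule.span R (Set.range b)) {x : K}
    (hx : x ∈ Submodule.span R (Set.range b)) : x ^ Nat.card k ∈ Submodule.span R (Set.range b) := by
  have := Fintype.ofFinite k
  induction hx using Submodule.span_induction with
  | mem x hx =>
    obtain ⟨g, rfl⟩ := hx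
    rw [hb g, ← map_pow]
    exact gal_apply_mem_span_range hb hpow g
  | zero =>
    rw [zero_pow Nat.card_pos.ne']
    exact zero_mem _
  | add x y _ _ hx hy =>
    have : (x + y) ^ Nat.card k = x ^ Nat.card k + y ^ Nat.card k := by
      rw [Nat.card_eq_fintype_card]
      exact map_add (FiniteField.frobeniusAlgHom k K) x y
    exact this ▸ add_mem hx hy
  | smul r x _ hx =>
    rw [smul_pow]
    exact Submodule.smul_mem _ _ hx

include hb in
/-- Recovering a vector from the conjugates of its coordinate at the identity. -/
theorem sum_gal_apply_coord_smul [FiniteDimensional F K] (x : K) :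
    ∑ g : Gal(K/F), g⁻¹ (b.coord 1 (g x) • b 1) = x := by
  classical
  have hcoord : ∀ g : Gal(K/F), b.coord 1 (g x) = b.coord g⁻¹ x := by
    intro g
    have h : (b.coord 1).comp g.toLinearMap = b.coord g⁻¹ := b.ext fun h => by
      rw [LinearMap.comp_apply, AlgEquiv.toLinearMap_apply, hb h, ← AlgEquiv.mul_apply, ← hb,
        ← hb, Module.Basis.coord_apply, Module.Basis.coord_apply, b.repr_self, b.repr_self,
        Finsupp.single_apply, Finsupp.single_apply]
      exact if_congr (by rw [mul_eq_one_iff_inv_eq, eq_comm]) rfl rfl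
    exact LinearMap.congr_fun h x
  conv_rhs => rw [← b.sum_repr x]
  refine Fintype.sum_equiv (Equiv.inv _) _ _ fun g => ?_
  rw [map_smul, hcoord, ← hb]
  rfl

end NormalBasisLattice

/-! ### Existence of taming modules -/

section TraceIdeal

variable (R F K : Type*) [CommRing R] [Field F] [Field K] [Algebra R F] [Algebra F K] [Algebra R K]
  [IsScalarTower R F K] [FiniteDimensional F K]

/-- The ideal of `R` formed by the traces of the elements of the integral closure of `R` in `K`. -/
noncomputable def traceIdeal : Ideal R :=
  (LinearMap.range (∑ g : Gal(K/F), galRep R F K g)).comap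
    (Algebra.linearMap R (integralClosure R K))

variable {R F K}

theorem mem_traceIdeal {u : R} : u ∈ traceIdeal R F K ↔ ∃ y : integralClosure R K,
    ∑ g : Gal(K/F), g • y = algebraMap R (integralClosure R K) u := by
  simp only [traceIdeal, Submodule.mem_comap, LinearMap.mem_range, LinearMap.sum_apply]
  rfl

end TraceIdeal

section LatticeSaturation

variable {k R F K : Type*} [CommRing R] [Field F] [Field K] [Algebra R F] [Algebra F K]
  [Algebra R K] [IsScalarTower R F K]

/-- The submodule of the integral closure `S` of `R` in `K` formed by the elements that are carried
into `N` by an element of `1 + I`. When `N` is a lattice in `K` contained in `S`, it agrees with `N`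
at the primes containing `I` and with `S` at all other primes. -/
noncomputable def latticeSaturation (N : Submodule R K) (hG : ∀ (g : Gal(K/F)), ∀ x ∈ N, g x ∈ N)
    (hτ : ∀ x ∈ N, x ^ Nat.card k ∈ N) (I : Ideal R) : TauGSubmodule k R F K where
  toSubmodule :=
    { carrier := {x | ∃ t, Ideal.Quotient.mk I t = 1 ∧ t • (x : K) ∈ N}
      zero_mem' := ⟨1, map_one _, by simp⟩
      add_mem' := by
        rintro x y ⟨s, hs, hx⟩ ⟨t, ht, hy⟩
        refine ⟨s * t, by rw [map_mul, hs, ht, one_mul], ?_⟩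
        have : (s * t) • ((x + y : integralClosure R K) : K) = t • s • (x : K) + s • t • (y : K) := by
          rw [Subalgebra.coe_add, smul_add, mul_smul, mul_smul, smul_comm t s (x : K)]
        rw [this]
        exact add_mem (N.smul_mem _ hx) (N.smul_mem _ hy)
      smul_mem' := by
        rintro r x ⟨t, ht, hx⟩
        refine ⟨t, ht, ?_⟩
        rw [Subalgebra.coe_smul, smul_comm]
        exact N.smul_mem r hx }
  apply_mem_toSubmodule := by
    rintro g x ⟨t, ht, hx⟩
    refine ⟨t, ht, ?_⟩
    have : t • ((galRep R F K g x : integralClosure R K) : K) = g (t • (x : K)) :=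
      (map_smul (g.restrictScalars R) t (x : K)).symm
    exact this ▸ hG g _ hx
  pow_mem_toSubmodule := by
    rintro x ⟨t, ht, hx⟩
    refine ⟨t ^ Nat.card k, by rw [map_pow, ht, one_pow], ?_⟩
    rw [SubmonoidClass.coe_pow, ← smul_pow]
    exact hτ _ hx

variable {N : Submodule R K} {hG : ∀ (g : Gal(K/F)), ∀ x ∈ N, g x ∈ N}
  {hτ : ∀ x ∈ N, x ^ Nat.card k ∈ N} {I : Ideal R}

theorem mem_latticeSaturation {x : integralClosure R K} :
    x ∈ (latticeSaturation N hG hτ I).toSubmodule ↔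
      ∃ t, Ideal.Quotient.mk I t = 1 ∧ t • (x : K) ∈ N :=
  Iff.rfl

theorem mem_latticeSaturation_of_mem {x : integralClosure R K} (hx : (x : K) ∈ N) :
    x ∈ (latticeSaturation N hG hτ I).toSubmodule :=
  ⟨1, map_one _, by rwa [one_smul]⟩

/-- Powers of an element of `I` carry `S` into the saturation: in the finite ring `R/rR`, two powers
`uⁿ` and `uⁿ⁺ᵐ⁺¹` agree, so that `uⁿ(1 - uᵐ⁺¹)` carries `S` into `N`. -/
theorem exists_pow_smul_mem_latticeSaturation {r : R} [Finite (R ⧸ Ideal.span {r})]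
    (hr : ∀ x : integralClosure R K, r • (x : K) ∈ N) {u : R} (hu : u ∈ I) :
    ∃ n, ∀ x : integralClosure R K, u ^ n • x ∈ (latticeSaturation N hG hτ I).toSubmodule := by
  obtain ⟨i, j, hij, h⟩ := Finite.exists_ne_map_eq_of_infinite
    fun n : ℕ => Ideal.Quotient.mk (Ideal.span {r}) (u ^ n)
  wlog hlt : i < j generalizing i j
  · exact this j i hij.symm h.symm (lt_of_le_of_ne (not_lt.1 hlt) hij.symm)
  obtain ⟨m, rfl⟩ := Nat.exists_eq_add_of_lt hlt
  obtain ⟨a, ha⟩ := Ideal.mem_span_singleton.1 (Ideal.Quotient.eq.1 h)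
  refine ⟨i, fun x => ⟨1 - u ^ (m + 1), ?_, ?_⟩⟩
  · rw [map_sub, map_one, map_pow, Ideal.Quotient.eq_zero_iff_mem.2 hu, zero_pow m.succ_ne_zero,
      sub_zero]
  · have : (1 - u ^ (m + 1)) * u ^ i = a * r := by
      rw [mul_comm a, ← ha]
      ring
    rw [Subalgebra.coe_smul, smul_smul, this, mul_smul]
    exact N.smul_mem a (hr x)

end LatticeSaturation

section Existence

variable {k R F K : Type*} [CommRing R] [IsDedekindDomain R] [Ring.HasFiniteQuotients R] [Field F]
  [Field K] [Algebra R F] [IsFractionRing R F] [Algebra F K] [Algebra R K] [IsScalarTower R F K]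
  [FiniteDimensional F K] [IsAbelianGalois F K]
  {b : Module.Basis Gal(K/F) F K} (hb : ∀ g, b g = g (b 1)) (hint : IsIntegral R (b 1))
  {hG : ∀ (g : Gal(K/F)), ∀ x ∈ Submodule.span R (Set.range b),
    g x ∈ Submodule.span R (Set.range b)}
  {hτ : ∀ x ∈ Submodule.span R (Set.range b), x ^ Nat.card k ∈ Submodule.span R (Set.range b)}

omit [Ring.HasFiniteQuotients R] in
theorem exists_smul_mem_span_range (b : Module.Basis Gal(K/F) F K) :
    ∃ r : R, r ≠ 0 ∧
      ∀ x : integralClosure R K, r • (x : K) ∈ Submodule.span R (Set.range b) := by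
  have : Module.Finite R (integralClosure R K) := IsIntegralClosure.finite R F K _
  obtain ⟨r, hr, h⟩ :=
    (Module.Finite.fg_top (R := R) (M := integralClosure R K)).exists_forall_smul_mem
    ((Submodule.span R (Set.range b)).comap (integralClosure R K).val.toLinearMap)
    (nonZeroDivisors R) fun x _ => b.exists_smul_mem_span (R := R) (x : K)
  exact ⟨r, nonZeroDivisors.ne_zero hr, fun x => h x trivial⟩

include hb hint in
/-- The projectivity of the saturation `M` of `N = R[G]θ` along the trace ideal. By Higman's
criterion it is enough to write the identity of `M` as a sum of conjugates. Let `t = 1 - u` carry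
`M` into `N`, where `u` is the trace of `y`, and let `uⁿ` carry `S` into `M`. If `ε` is the
projection of `N` onto the line `Rθ`, then `x ↦ ε(tx)` and `x ↦ uⁿyx` are endomorphisms of `M` with
conjugates summing to `t = 1 - u` and `uⁿ⁺¹`, and these two elements generate the unit ideal. -/
theorem projective_latticeSaturation :
    Module.Projective R[Gal(K/F)]
      (latticeSaturation (Submodule.span R (Set.range b)) hG hτ (traceIdeal R F K)).AsModule := by
  let N := Submodule.span R (Set.range b)
  let M := latticeSaturation N hG hτ (traceIdeal R F K)
  have : FaithfulSMul R (integralClosure R K) := faithfulSMul_integralClosure R F K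
  have : Module.Finite R (integralClosure R K) := IsIntegralClosure.finite R F K _
  have := Module.finitePresentation_of_finite R M.toSubmodule
  have : Module.Projective R M.toSubmodule := Module.Flat.projective_of_finitePresentation
  obtain ⟨r, hr, hrS⟩ := exists_smul_mem_span_range (R := R) b
  have : Finite (R ⧸ Ideal.span {r}) := Ring.HasFiniteQuotients.finiteQuotient (by simpa using hr)
  obtain ⟨t, ht, htM⟩ := (IsNoetherian.noetherian M.toSubmodule).exists_forall_smul_mem
    (N.comap (integralClosure R K).val.toLinearMap)
    (MonoidHom.mker (Ideal.Quotient.mk (traceIdeal R F K) : R →* R ⧸ traceIdeal R F K))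
    fun x ⟨t, ht, htx⟩ => ⟨t, ht, htx⟩
  have hu : 1 - t ∈ traceIdeal R F K := Ideal.Quotient.eq.1 ((map_one _).trans ht.symm)
  obtain ⟨y, hy⟩ := mem_traceIdeal.1 hu
  obtain ⟨n, hn⟩ := exists_pow_smul_mem_latticeSaturation (hG := hG) (hτ := hτ) hrS hu
  -- With `u = 1 - t`, the Bézout relation `ct + uⁿ⁺¹ = 1` makes the conjugates of `Φ` sum to `1`.
  let c := ∑ i ∈ Finset.range (n + 1), (1 - t) ^ i
  have hc : c * t + (1 - t) ^ (n + 1) = 1 := by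
    have := geom_sum_mul_neg (1 - t) (n + 1)
    rw [sub_sub_cancel] at this
    rw [this, sub_add_cancel]
  let φ₁ : K →ₗ[R] K := ((LinearMap.toSpanSingleton F K (b 1)) ∘ₗ b.coord 1).restrictScalars R
  let φ₂ : K →ₗ[R] K := LinearMap.mulLeft R (y : K)
  let Φ : K →ₗ[R] K := c • (φ₁ ∘ₗ LinearMap.lsmul R K t) + (1 - t) ^ n • φ₂
  have hΦ : ∀ x ∈ M.toSubmodule, ∃ z ∈ M.toSubmodule, (z : K) = Φ x := by
    intro x hx
    obtain ⟨a, ha⟩ := (b.mem_span_iff_repr_mem R _).1 (htM x hx) 1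
    have hθ : (⟨b 1, hint⟩ : integralClosure R K) ∈ M.toSubmodule :=
      mem_latticeSaturation_of_mem (Submodule.subset_span ⟨1, rfl⟩)
    refine ⟨_, add_mem (M.toSubmodule.smul_mem (c * a) hθ) (hn (y * x)), ?_⟩
    have : φ₁ (t • (x : K)) = a • b 1 := by
      rw [← algebraMap_smul F a, ha]
      rfl
    simp only [Φ, LinearMap.add_apply, LinearMap.smul_apply, LinearMap.comp_apply,
      LinearMap.lsmul_apply, this, mul_smul]
    rfl
  let ι : M.toSubmodule →ₗ[R] K := (integralClosure R K).val.toLinearMap ∘ₗ M.toSubmodule.subtype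
  let φS : M.toSubmodule →ₗ[R] integralClosure R K :=
    (Φ ∘ₗ ι).codRestrict (integralClosure R K).toSubmodule fun x => by
      obtain ⟨z, -, hz⟩ := hΦ x x.2
      exact hz ▸ z.2
  let φ : M.toSubmodule →ₗ[R] M.toSubmodule := φS.codRestrict M.toSubmodule fun x => by
    obtain ⟨z, hzM, hz⟩ := hΦ x x.2
    have : z = φS x := Subtype.ext hz
    exact this ▸ hzM
  refine M.toSubrepresentation.toRepresentation.projective_asModule_of_sum_eq φ fun x => ?_
  have hι : Function.Injective ι := Subtype.val_injective.comp Subtype.val_injective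
  refine hι ?_
  have hterm : ∀ g : Gal(K/F), ι (M.toSubrepresentation.toRepresentation g⁻¹
      (φ (M.toSubrepresentation.toRepresentation g x))) =
        c • g⁻¹ (b.coord 1 (g (t • ι x)) • b 1) + (1 - t) ^ n • (g⁻¹ (y : K) * ι x) := by
    intro g
    have hgt : g (t • ι x) = t • g (ι x) := map_smul (g.restrictScalars R) t _
    have hinv : g⁻¹ (g (ι x)) = ι x := by rw [← AlgEquiv.mul_apply, inv_mul_cancel, AlgEquiv.one_apply]
    have hsmul : ∀ (a : R) (z : K), g⁻¹ (a • z) = a • g⁻¹ z := map_smul (g⁻¹.restrictScalars R)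
    have h : ι (M.toSubrepresentation.toRepresentation g⁻¹
        (φ (M.toSubrepresentation.toRepresentation g x))) =
          g⁻¹ (c • φ₁ (t • g (ι x)) + (1 - t) ^ n • ((y : K) * g (ι x))) := rfl
    rw [h, map_add, hsmul, hsmul, map_mul, hinv, hgt]
    rfl
  have hysum : ∑ g : Gal(K/F), g⁻¹ (y : K) = algebraMap R K (1 - t) := by
    rw [← Equiv.sum_comp (Equiv.inv Gal(K/F))]
    have h := congrArg (algebraMap (integralClosure R K) K) hy
    rw [map_sum, ← IsScalarTower.algebraMap_apply] at h
    rw [← h]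
    exact Finset.sum_congr rfl fun g _ => by
      rw [Equiv.inv_apply, inv_inv]
      rfl
  rw [map_sum, Finset.sum_congr rfl fun g _ => hterm g, Finset.sum_add_distrib, ← Finset.smul_sum,
    ← Finset.smul_sum, ← Finset.sum_mul, sum_gal_apply_coord_smul hb, hysum, ← Algebra.smul_def,
    smul_smul, smul_smul, ← add_smul, ← pow_succ, hc, one_smul]

include hb hint in
/-- The saturation of the lattice `R[G]θ` along the trace ideal is a taming module, since a tame
prime does not contain the trace ideal. -/
theorem isTamingModule_latticeSaturation :
    IsTamingModule
      (latticeSaturation (Submodule.span R (Set.range b)) hG hτ (traceIdeal R F K)) := by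
  let N := Submodule.span R (Set.range b)
  let M := latticeSaturation N hG hτ (traceIdeal R F K)
  have : FaithfulSMul R (integralClosure R K) := faithfulSMul_integralClosure R F K
  have : Module.Finite R (integralClosure R K) := IsIntegralClosure.finite R F K _
  have hproj : Module.Projective R[Gal(K/F)] M.AsModule := projective_latticeSaturation hb hint
  obtain ⟨r, hr, hrS⟩ := exists_smul_mem_span_range (R := R) b
  have : Finite (R ⧸ Ideal.span {r}) := Ring.HasFiniteQuotients.finiteQuotient (by simpa using hr)
  refine ⟨hproj, ?_, ?_, fun v hv => ?_⟩
  · have : Module.Finite R[Gal(K/F)] M.AsModule := Module.Finite.of_restrictScalars_finite R _ _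
    have : Module.Free R R[Gal(K/F)] := .of_basis (MonoidAlgebra.basis _ R)
    classical
    let ρ := M.toSubrepresentation.toRepresentation
    let θ : M.AsModule := ρ.asModuleEquiv.symm ⟨⟨b 1, hint⟩,
      mem_latticeSaturation_of_mem (Submodule.subset_span ⟨1, rfl⟩)⟩
    let ι : M.AsModule →ₗ[R] K := (integralClosure R K).val.toLinearMap ∘ₗ
      M.toSubmodule.subtype ∘ₗ ρ.asModuleEquiv.toLinearMap
    have hι : Function.Injective ι := Subtype.val_injective.comp Subtype.val_injective
    let f : R[Gal(K/F)] →ₗ[R[Gal(K/F)]] M.AsModule := LinearMap.toSpanSingleton _ _ θ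
    have hf : ∀ a : R[Gal(K/F)], ι (f a) =
        Fintype.linearCombination R b ((MonoidAlgebra.basis _ R).equivFun a) := by
      intro a
      induction a using MonoidAlgebra.induction_linear with
      | zero => simp
      | add a a' ha ha' => simp only [map_add, ha, ha']
      | single g s =>
        have h₁ : f (MonoidAlgebra.single g s) =
            s • ρ.asModuleEquiv.symm (ρ g (ρ.asModuleEquiv θ)) :=
          Representation.single_smul ρ s g θ
        have h₂ : MonoidAlgebra.single g s = s • MonoidAlgebra.basis Gal(K/F) R g := by
          rw [MonoidAlgebra.basis_apply, MonoidAlgebra.smul_single, smul_eq_mul, mul_one]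
        rw [h₁, h₂, map_smul, map_smul, map_smul, Module.Basis.equivFun_apply,
          Module.Basis.repr_self, Finsupp.single_eq_pi_single,
          Fintype.linearCombination_apply_single, one_smul, hb g]
        rfl
    have hli : LinearIndependent R b := b.linearIndependent.restrict_scalars
      ((faithfulSMul_iff_injective_smul_one R F).1 inferInstance)
    refine rankAtStalk_eq_one_of_smul_mem_range (R := R) f (fun a a' h => ?_) hr fun x => ?_
    · have h' := congrArg ι h
      rw [hf, hf] at h'
      exact (MonoidAlgebra.basis _ R).equivFun.injective
        (hli.fintypeLinearCombination_injective h')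
    · have hx : r • ι x ∈ Submodule.span R (Set.range b) := hrS _
      rw [← Fintype.range_linearCombination] at hx
      obtain ⟨c, hc⟩ := hx
      refine ⟨(MonoidAlgebra.basis _ R).equivFun.symm c, hι ?_⟩
      rw [hf, LinearEquiv.apply_symm_apply, hc, algebraMap_smul, map_smul]
  · have hle : (Ideal.span {r} • ⊤ : Submodule R (integralClosure R K)) ≤ M.toSubmodule := by
      rw [Submodule.ideal_span_singleton_smul]
      rintro _ ⟨x, -, rfl⟩
      exact mem_latticeSaturation_of_mem (hrS x)
    have := Submodule.finite_quotient_smul (Ideal.span {r})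
      (N := (⊤ : Submodule R (integralClosure R K)))
      Module.Finite.fg_top
    exact Finite.of_surjective _ (Submodule.factor_surjective hle)
  · obtain ⟨y, u, hu, hy⟩ := hv.exists_trace_notMem (F := F)
    obtain ⟨n, hn⟩ := exists_pow_smul_mem_latticeSaturation (hG := hG) (hτ := hτ) hrS
      (mem_traceIdeal.2 ⟨y, hy⟩)
    refine subsingleton_tensorProduct_adicCompletionIntegers F v
      (fun h => hu (v.isPrime.mem_of_pow_mem n h)) fun q => ?_
    obtain ⟨x, rfl⟩ := Submodule.Quotient.mk_surjective _ q
    exact (Submodule.Quotient.mk_eq_zero _).2 (hn x)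

end Existence

theorem propositionP
    -- the finite field `𝔽_q`
    (k : Type*) [Field k] [Finite k]
    -- `F` is a finite separable extension of `𝔽_q(t)`
    (F : Type*) [Field F] [Algebra k F] [Algebra (RatFunc k) F] [IsScalarTower k (RatFunc k) F]
    [FiniteDimensional (RatFunc k) F] [Algebra.IsSeparable (RatFunc k) F]
    -- `K/F` is finite abelian, and `𝔽_q` is algebraically closed in `K`
    (K : Type*) [Field K] [Algebra F K] [FiniteDimensional F K] [IsAbelianGalois F K]
    [Algebra k K] [IsScalarTower k F K] (_hk : algebraicClosure k K = ⊥)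
    -- `R` is a Dedekind domain with field of fractions `F`
    (R : Type*) [CommRing R] [IsDedekindDomain R] [Algebra R F] [IsFractionRing R F]
    [Algebra R K] [IsScalarTower R F K] [Algebra k R] [IsScalarTower k R F] [IsScalarTower k R K] :
    -- taming modules exist
    (∃ M : TauGSubmodule k R F K, IsTamingModule M) ∧
    -- if `S/R` is tame, every taming module is equal to `S`
    ((∀ v : HeightOneSpectrum R, IsTameAt R K v) →
      ∀ M : TauGSubmodule k R F K, IsTamingModule M → M.toSubmodule = ⊤) ∧
    -- `M/v ≅ 𝔽_q[G] ^ [R/v : 𝔽_q]`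
    (∀ M : TauGSubmodule k R F K, IsTamingModule M → ∀ v : HeightOneSpectrum R,
      Module.Finite k (R ⧸ v.asIdeal) ∧
      Nonempty (M.FiberAsModule v.asIdeal ≃ₗ[k[Gal(K/F)]]
        (Fin (Module.finrank k (R ⧸ v.asIdeal)) → k[Gal(K/F)]))) ∧
    -- `M/v = S/v` at the tame primes
    (∀ M : TauGSubmodule k R F K, IsTamingModule M → ∀ v : HeightOneSpectrum R, IsTameAt R K v →
      Function.Bijective (ModFiber.map v.asIdeal M.toSubmodule.subtype)) := by

  have hR : Ring.HasFiniteQuotients R := hasFiniteQuotients_of_ratFunc (k := k) (F := F) R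
  have hinf : Infinite R := by
    have : Infinite (RatFunc k) := .of_injective _ (RatFunc.algebraMap_injective k)
    have hF : Infinite F := .of_injective _ (algebraMap (RatFunc k) F).injective
    rw [Cardinal.infinite_iff] at hF ⊢
    have h := IsLocalization.lift_cardinalMk_le (L := F) (nonZeroDivisors R)
    simpa using (Cardinal.lift_le.2 hF).trans h
  refine ⟨?_, fun h M hM => hM.toSubmodule_eq_top h, fun M hM v => ?_,
    fun M hM v hv => hM.bijective_map_subtype hv⟩
  · obtain ⟨b, hb, hint, hpow⟩ := exists_basis_pow_mem_span k R F K
    exact ⟨_, isTamingModule_latticeSaturation hb hint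
      (hG := fun g x hx => gal_apply_mem_span_range hb hx g)
      (hτ := fun x hx => pow_card_mem_span_range hb hpow hx)⟩
  · have : Finite (R ⧸ v.asIdeal) := hR.finiteQuotient v.ne_bot
    have : Module.Finite k (R ⧸ v.asIdeal) := inferInstance
    exact ⟨this, hM.nonempty_fiberAsModule_linearEquiv v.asIdeal⟩
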